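/- Identify subsets of $\mathbb{N}^d$ with their characteristic functions. For $d<\omega$ and $A\subseteq\mathbb{N}^d$ let $Q_A=\{X\subseteq\mathbb{N}^d : A\subseteq X\}$. Let $\mathcal{F}=\langle Q_i : i\in I\rangle$, with $I$ countable (for example $I=\omega$), be a family such that for each $i$ there is $d_i<\omega$ for which $Q_i$ is a set of subsets of $\mathbb{N}^{d_i}$ that is a finite boolean combination (by unions, intersections and complements in the power set of $\mathbb{N}^{d_i}$) of sets of the form $Q_{A}$ with $A\subseteq\mathbb{N}^{d_i}$. Let $S_\infty$ be the group of permutations of $\mathbb{N}$ with the topology of pointwise convergence (the subspace topology from $\mathbb{N}^{\mathbb{N}}$), acting coordinatewise on tuples, and let $\mathrm{Aut}(\mathcal{F})$ be the subgroup of all $g\in S_\infty$ such that for all $i$ and all $X\subseteq\mathbb{N}^{d_i}$, $X\in Q_i$ if and only if $g(X)\in Q_i$, where $g(X)=\{g(x):x\in X\}$. Let $\mathscr{L}_{\omega_1\omega}(\mathcal{F})$ be the logic built from equality between variables by negation, countable conjunctions and disjunctions, the quantifiers $\forall,\exists$, and for each $i$ a quantifier binding a $d_i$-tuple of variables, where $Q_i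 x\,\varphi(x,\bar b)$ holds in $\mathbb{N}$ if and only if $\{x\in\mathbb{N}^{d_i} : \mathbb{N}\vDash\varphi(x,\bar b)\}\in Q_i$; formulas have finitely many free variables and no parameters. Then $\mathrm{Aut}(\mathcal{F})$ is closed in $S_\infty$, and for every $j<\omega$ and every $\bar a\in\mathbb{N}^j$ the orbit $\{g(\bar a) : g\in\mathrm{Aut}(\mathcal{F})\}\subseteq\mathbb{N}^j$ is definable in $\mathscr{L}_{\omega_1\omega}(\mathcal{F})$, that is, there is a formula $\varphi$ of $\mathscr{L}_{\omega_1\omega}(\mathcal{F})$ with free variables among $v_0,\dots,v_{j-1}$ such that for all $\bar b\in\mathbb{N}^j$, $\bar b$ is in the orbit if and only if $\mathbb{N}\vDash\varphi(\bar b)$. -/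

import Mathlib

open scoped Topology

namespace GenQuant

/-- A generalized quantifier of type `⟨k⟩` on the natural numbers: a set of subsets of `ℕ^k`. -/
abbrev Quantifier (k : ℕ) : Type := Set (Set (Fin k → ℕ))

/-- The principal quantifier `Q_A = {X ⊆ ℕ^k : A ⊆ X}`. -/
def principal {k : ℕ} (A : Set (Fin k → ℕ)) : Quantifier k := {X | A ⊆ X}

/-- `Q` is a finite boolean combination of principal quantifiers `Q_A`, `A ⊆ ℕ^k`: it lies in
the boolean algebra of subsets of `𝒫(ℕ^k)` generated by them (unions, intersections and
complements). -/
def IsPrincipalCombination {k : ℕ} (Q : Quantifier k) : Prop :=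
  Q ∈ BooleanSubalgebra.closure (Set.range (principal (k := k)))

/-- The image `g(X) = {g(x) : x ∈ X}` of a set of `k`-tuples, where `g` acts coordinatewise. -/
def permImage (g : Equiv.Perm ℕ) {k : ℕ} (X : Set (Fin k → ℕ)) : Set (Fin k → ℕ) :=
  (fun x : Fin k → ℕ => fun i => g (x i)) '' X

/-- The permutation `g` fixes the quantifier `Q`. -/
def Fixes (g : Equiv.Perm ℕ) {k : ℕ} (Q : Quantifier k) : Prop :=
  ∀ X : Set (Fin k → ℕ), X ∈ Q ↔ permImage g X ∈ Q

theorem permImage_one {k : ℕ} (X : Set (Fin k → ℕ)) : permImage 1 X = X := by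
  simp [permImage]

theorem permImage_mul (g h : Equiv.Perm ℕ) {k : ℕ} (X : Set (Fin k → ℕ)) :
    permImage (g * h) X = permImage g (permImage h X) := by
  simp [permImage, Set.image_image]

/-- `Aut(F)`: the group of all permutations of `ℕ` fixing every quantifier of the family `F`. -/
def Aut {ι : Type*} {d : ι → ℕ} (F : ∀ i, Quantifier (d i)) : Subgroup (Equiv.Perm ℕ) where
  carrier := {g | ∀ i, Fixes g (F i)}
  one_mem' := fun i X => by rw [permImage_one]
  mul_mem' := fun {g h} hg hh i X => by
    rw [permImage_mul]
    exact (hh i X).trans (hg i _)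
  inv_mem' := fun {g} hg i X => by
    rw [hg i (permImage g⁻¹ X), ← permImage_mul, mul_inv_cancel, permImage_one]

/-- The topology of `S_∞`: the subspace topology from the product `ℕ^ℕ` of discrete spaces
(pointwise convergence). -/
abbrev permTopology : TopologicalSpace (Equiv.Perm ℕ) :=
  TopologicalSpace.induced (fun g : Equiv.Perm ℕ => (g : ℕ → ℕ)) inferInstance

/-- The orbit `{g(a) : g ∈ G}` of a tuple `a ∈ ℕ^j`. -/
def orb (G : Subgroup (Equiv.Perm ℕ)) {j : ℕ} (a : Fin j → ℕ) : Set (Fin j → ℕ) :=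
  {b | ∃ g ∈ G, ∀ i, g (a i) = b i}

/-- Formulas of `L_{ω₁ω}(F)` for a family of quantifiers of types `⟨d i⟩`, without nonlogical
symbols and without parameters; the free variables of a formula in `Formula d n` are among
`v_0, …, v_{n-1}`, so every formula has finitely many free variables. In `all φ` and `ex φ` the
variable `v_n` of `φ` is bound, in `quant i φ` the variables `v_n, …, v_{n + d i - 1}`.
Finite conjunctions and disjunctions are countable ones with repetitions. -/
inductive Formula {ι : Type*} (d : ι → ℕ) : ℕ → Type _
  | equal {n : ℕ} (s t : Fin n) : Formula d n
  | neg {n : ℕ} (φ : Formula d n) : Formula d n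
  | conj {n : ℕ} (φ : ℕ → Formula d n) : Formula d n
  | disj {n : ℕ} (φ : ℕ → Formula d n) : Formula d n
  | all {n : ℕ} (φ : Formula d (n + 1)) : Formula d n
  | ex {n : ℕ} (φ : Formula d (n + 1)) : Formula d n
  | quant {n : ℕ} (i : ι) (φ : Formula d (n + d i)) : Formula d n

/-- Satisfaction `ℕ ⊨ φ(v)`, the `i`-th quantifier symbol being interpreted by `F i`. -/
def Formula.Sat {ι : Type*} {d : ι → ℕ} (F : ∀ i, Quantifier (d i)) :
    {n : ℕ} → Formula d n → (Fin n → ℕ) → Prop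
  | _, .equal s t, v => v s = v t
  | _, .neg φ, v => ¬ φ.Sat F v
  | _, .conj φ, v => ∀ m, (φ m).Sat F v
  | _, .disj φ, v => ∃ m, (φ m).Sat F v
  | _, .all φ, v => ∀ y : ℕ, φ.Sat F (Fin.snoc v y)
  | _, .ex φ, v => ∃ y : ℕ, φ.Sat F (Fin.snoc v y)
  | _, .quant i φ, v => {x : Fin (d i) → ℕ | φ.Sat F (Fin.append v x)} ∈ F i

/-- The set `A ⊆ ℕ^j` is definable in `L_{ω₁ω}(F)`. -/
def Definable {ι : Type*} {d : ι → ℕ} (F : ∀ i, Quantifier (d i)) {j : ℕ}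
    (A : Set (Fin j → ℕ)) : Prop :=
  ∃ φ : Formula d j, ∀ b : Fin j → ℕ, b ∈ A ↔ φ.Sat F b

end GenQuant

namespace GenQuant

/-! A failure of `A ⊆ X` is witnessed by a single point outside `X`, so for a boolean combination
`Q` membership of `X` is decided by finitely many points outside `X`. Hence a permutation fixes `Q`
once it preserves the cofinite members of `Q` (`IsPrincipalCombination.fixes`). For each finite `Z`
this condition involves finitely many values of `g`, so `Aut F` is closed. It is also expressible in
the logic about a tuple listing the entries of `Z` (`Definable.compl_range_mem`), so a bijection all
of whose finite parts preserve types is an automorphism. As there are only countably many tuples,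
each type is a single definable set (`SameType.definable`); this drives a back and forth which shows
that orbits are exactly types. -/

theorem IsPrincipalCombination.exists_finite {k : ℕ} {Q : Quantifier k}
    (hQ : IsPrincipalCombination Q) (X : Set (Fin k → ℕ)) :
    ∃ W : Set (Fin k → ℕ), W.Finite ∧ W ⊆ Xᶜ ∧
      ∀ Z, W ⊆ Z → Z ⊆ Xᶜ → (X ∈ Q ↔ Zᶜ ∈ Q) := by
  unfold IsPrincipalCombination at hQ
  induction hQ using BooleanSubalgebra.closure_bot_sup_induction with
  | mem P hP =>
    obtain ⟨A, rfl⟩ := hP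
    by_cases hA : A ⊆ X
    · refine ⟨∅, Set.finite_empty, Set.empty_subset _, fun Z _ hZ => ?_⟩
      exact iff_of_true hA fun x hx hxZ => hZ hxZ (hA hx)
    · obtain ⟨x, hxA, hxX⟩ := Set.not_subset.1 hA
      refine ⟨{x}, Set.finite_singleton x, by simpa using hxX, fun Z hZ _ => ?_⟩
      exact iff_of_false hA fun h => h hxA (hZ rfl)
  | bot => exact ⟨∅, Set.finite_empty, Set.empty_subset _, fun Z _ _ => Iff.rfl⟩
  | sup P _ P' _ ih ih' =>
    obtain ⟨W, hW, hWX, h⟩ := ih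
    obtain ⟨W', hW', hWX', h'⟩ := ih'
    refine ⟨W ∪ W', hW.union hW', Set.union_subset hWX hWX', fun Z hZ hZX => ?_⟩
    exact or_congr (h Z (Set.subset_union_left.trans hZ) hZX)
      (h' Z (Set.subset_union_right.trans hZ) hZX)
  | compl P _ ih =>
    obtain ⟨W, hW, hWX, h⟩ := ih
    exact ⟨W, hW, hWX, fun Z hZ hZX => not_congr (h Z hZ hZX)⟩

theorem comp_injective (g : Equiv.Perm ℕ) (k : ℕ) :
    Function.Injective (fun x : Fin k → ℕ => fun i => g (x i)) :=
  fun _ _ h => funext fun i => g.injective (congrFun h i)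

theorem permImage_compl (g : Equiv.Perm ℕ) {k : ℕ} (X : Set (Fin k → ℕ)) :
    permImage g Xᶜ = (permImage g X)ᶜ :=
  Set.image_compl_eq ⟨comp_injective g k, fun y => ⟨fun i => g⁻¹ (y i), by simp⟩⟩

/-- A permutation fixes a combination of principal quantifiers as soon as it preserves its
cofinite members. -/
theorem IsPrincipalCombination.fixes {k : ℕ} {Q : Quantifier k}
    (hQ : IsPrincipalCombination Q) (g : Equiv.Perm ℕ)
    (h : ∀ Z : Set (Fin k → ℕ), Z.Finite → (Zᶜ ∈ Q ↔ (permImage g Z)ᶜ ∈ Q)) : Fixes g Q := by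
  intro X
  obtain ⟨W, hW, hWX, h₁⟩ := hQ.exists_finite X
  obtain ⟨W', hW', hWX', h₂⟩ := hQ.exists_finite (permImage g X)
  have hinv : permImage g (permImage g⁻¹ W') = W' := by
    rw [← permImage_mul, mul_inv_cancel, permImage_one]
  have hsub : permImage g⁻¹ W' ⊆ Xᶜ := by
    have := Set.image_mono (f := fun x : Fin k → ℕ => fun i => g⁻¹ (x i)) hWX'
    change permImage g⁻¹ W' ⊆ permImage g⁻¹ (permImage g X)ᶜ at this
    rwa [← permImage_compl, ← permImage_mul, inv_mul_cancel, permImage_one] at this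
  -- One finite set serves both sides: it contains `W` and avoids `X`, while its image contains `W'`
  -- and avoids the image of `X`.
  rw [h₁ (W ∪ permImage g⁻¹ W') Set.subset_union_left (Set.union_subset hWX hsub),
    h (W ∪ permImage g⁻¹ W') (hW.union (hW'.image _)), ← h₂]
  · rw [permImage, Set.image_union]
    exact hinv.symm.subset.trans Set.subset_union_right
  · rw [← permImage_compl]
    exact Set.image_mono (Set.union_subset hWX hsub)

variable {ι : Type*} {d : ι → ℕ} {F : ∀ i, Quantifier (d i)}

theorem isClosed_aut (hF : ∀ i, IsPrincipalCombination (F i)) :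
    IsClosed[permTopology] (Aut F : Set (Equiv.Perm ℕ)) := by
  let := permTopology
  have key : (Aut F : Set (Equiv.Perm ℕ)) = ⋂ (i) (Z : Set (Fin (d i) → ℕ)) (_ : Z.Finite),
      {g | Zᶜ ∈ F i ↔ (permImage g Z)ᶜ ∈ F i} := by
    ext g
    simp only [Set.mem_iInter, Set.mem_ofPred_eq]
    refine ⟨fun hg i Z _ => ?_, fun h i => (hF i).fixes g (h i)⟩
    rw [← permImage_compl]
    exact hg i _
  rw [key]
  refine isClosed_iInter fun i => isClosed_iInter fun Z => isClosed_iInter fun hZ => ?_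
  rw [← isOpen_compl_iff, isOpen_iff_forall_mem_open]
  intro g hg
  -- The condition is constant on the permutations agreeing with `g` on the finitely many entries of
  -- `Z`.
  refine ⟨⋂ z ∈ Z, ⋂ l, {f : Equiv.Perm ℕ | f (z l) = g (z l)}, fun f hf => ?_, ?_, by simp⟩
  · simp only [Set.mem_iInter, Set.mem_ofPred_eq] at hf
    have : permImage f Z = permImage g Z := Set.image_congr fun z hz => funext (hf z hz)
    simpa only [Set.mem_compl_iff, Set.mem_ofPred_eq, this] using hg
  · refine hZ.isOpen_biInter fun z _ => isOpen_iInter_of_finite fun l => ?_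
    have hc : Continuous fun f : Equiv.Perm ℕ => f (z l) :=
      (continuous_apply (z l)).comp continuous_induced_dom
    exact (isOpen_discrete {g (z l)}).preimage hc

/-- Bound variables range over all of `ℕ`, which `g` merely reindexes; only the case of `quant`
needs `g ∈ Aut F`. -/
theorem sat_comp_iff {g : Equiv.Perm ℕ} (hg : g ∈ Aut F) {n : ℕ} (φ : Formula d n)
    (v : Fin n → ℕ) : φ.Sat F v ↔ φ.Sat F (fun i => g (v i)) := by
  have hsnoc {n : ℕ} (v : Fin n → ℕ) (y : ℕ) : (fun i => g ((Fin.snoc v y : Fin (n + 1) → ℕ) i)) =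
      (Fin.snoc (fun i => g (v i)) (g y) : Fin (n + 1) → ℕ) := by
    funext i
    cases i using Fin.lastCases <;> simp
  induction φ with
  | equal s t => exact g.injective.eq_iff.symm
  | neg φ ih => exact not_congr (ih v)
  | conj φ ih => exact forall_congr' fun m => ih m v
  | disj φ ih => exact exists_congr fun m => ih m v
  | all φ ih =>
    refine Iff.trans (forall_congr' fun y => ?_) (g.surjective.forall (p := fun y =>
      φ.Sat F (Fin.snoc (fun i => g (v i)) y))).symm
    exact (ih _).trans (by rw [hsnoc])
  | ex φ ih =>
    refine Iff.trans (exists_congr fun y => ?_) (g.surjective.exists (p := fun y =>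
      φ.Sat F (Fin.snoc (fun i => g (v i)) y))).symm
    exact (ih _).trans (by rw [hsnoc])
  | @quant n i φ ih =>
    have happ (x : Fin (d i) → ℕ) : (fun l => g (Fin.append v x l)) =
        Fin.append (fun l => g (v l)) (fun l => g (x l)) := by
      funext l
      cases l using Fin.addCases <;> simp
    have : permImage g {x | φ.Sat F (Fin.append v x)} =
        {x | φ.Sat F (Fin.append (fun l => g (v l)) x)} := by
      ext y
      constructor
      · rintro ⟨x, hx, rfl⟩
        have := (ih _).1 hx
        rwa [happ] at this
      · intro hy
        refine ⟨fun l => g⁻¹ (y l), ?_, by simp⟩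
        refine (ih _).2 ?_
        rw [happ]
        simpa using hy
    change _ ∈ F i ↔ _ ∈ F i
    rw [← this]
    exact hg i _

namespace Definable

theorem equal {n : ℕ} (s t : Fin n) : Definable F {v | v s = v t} :=
  ⟨.equal s t, fun _ => Iff.rfl⟩

theorem compl {n : ℕ} {A : Set (Fin n → ℕ)} (hA : Definable F A) : Definable F Aᶜ := by
  obtain ⟨φ, hφ⟩ := hA
  exact ⟨.neg φ, fun b => not_congr (hφ b)⟩

theorem univ (n : ℕ) : Definable F (Set.univ : Set (Fin n → ℕ)) :=
  -- The bound variable supplies an equation even when `n = 0`.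
  ⟨.all (.equal (Fin.last n) (Fin.last n)), fun _ => iff_of_true trivial fun _ => rfl⟩

theorem iInter {κ : Type*} [Countable κ] {n : ℕ} {A : κ → Set (Fin n → ℕ)}
    (hA : ∀ k, Definable F (A k)) : Definable F (⋂ k, A k) := by
  rcases isEmpty_or_nonempty κ with h | h
  · rw [Set.iInter_of_empty]
    exact univ n
  · obtain ⟨e, he⟩ := exists_surjective_nat κ
    choose φ hφ using hA
    refine ⟨.conj fun m => φ (e m), fun b => ?_⟩
    rw [Set.mem_iInter, he.forall]
    exact forall_congr' fun m => hφ (e m) b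

theorem exists_snoc {n : ℕ} {A : Set (Fin (n + 1) → ℕ)} (hA : Definable F A) :
    Definable F {v : Fin n → ℕ | ∃ y : ℕ, (Fin.snoc v y : Fin (n + 1) → ℕ) ∈ A} := by
  obtain ⟨φ, hφ⟩ := hA
  exact ⟨.ex φ, fun b => exists_congr fun y => hφ _⟩

theorem quant {n : ℕ} (i : ι) {A : Set (Fin (n + d i) → ℕ)} (hA : Definable F A) :
    Definable F {v : Fin n → ℕ | {x : Fin (d i) → ℕ | Fin.append v x ∈ A} ∈ F i} := by
  obtain ⟨φ, hφ⟩ := hA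
  refine ⟨.quant i φ, fun b => ?_⟩
  simp only [Set.mem_ofPred_eq, hφ]
  exact Iff.rfl

/-- Membership in `F i` of the complement of a countable set of tuples formed from the free
variables is definable. -/
theorem compl_range_mem {κ : Type*} [Countable κ] {n : ℕ} (i : ι) (z : κ → Fin (d i) → Fin n) :
    Definable F {v : Fin n → ℕ | (Set.range fun k => v ∘ z k)ᶜ ∈ F i} := by
  have h := quant (F := F) i (iInter fun k => compl (iInter fun l =>
    equal (Fin.castAdd (d i) (z k l)) (Fin.natAdd n l)))
  convert h using 4 with v
  ext x
  simp [funext_iff]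

end Definable

variable (F) in
/-- Two tuples are equivalent if they lie in the same definable sets. -/
def SameType {n : ℕ} (a b : Fin n → ℕ) : Prop :=
  ∀ A : Set (Fin n → ℕ), Definable F A → (a ∈ A ↔ b ∈ A)

namespace SameType

theorem symm {n : ℕ} {a b : Fin n → ℕ} (h : SameType F a b) : SameType F b a :=
  fun A hA => (h A hA).symm

/-- One separating definable set is chosen for each of the countably many inequivalent tuples, and
these sets are intersected. -/
theorem definable {n : ℕ} (a : Fin n → ℕ) : Definable F {b | SameType F a b} := by
  have hsep (b : {b // ¬ SameType F a b}) : ∃ A, Definable F A ∧ a ∈ A ∧ b.1 ∉ A := by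
    obtain ⟨A, hA, hne⟩ : ∃ A, Definable F A ∧ ¬ (a ∈ A ↔ b.1 ∈ A) := by
      simpa only [SameType, not_forall, exists_prop] using b.2
    by_cases ha : a ∈ A
    · exact ⟨A, hA, ha, fun hb => hne (iff_of_true ha hb)⟩
    · exact ⟨Aᶜ, hA.compl, ha, fun hb => hne (iff_of_false ha hb)⟩
  choose A hA haA hbA using hsep
  convert Definable.iInter hA using 1
  ext b
  rw [Set.mem_iInter]
  refine ⟨fun hb c => (hb _ (hA c)).1 (haA c), fun hb => ?_⟩
  by_contra hne
  exact hbA ⟨b, hne⟩ (hb ⟨b, hne⟩)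

/-- The type of the extended tuple is one definable set, so having an extension in it is itself a
definable property of `a`, hence shared by `b`. -/
theorem exists_snoc {n : ℕ} {a b : Fin n → ℕ} (h : SameType F a b) (c : ℕ) :
    ∃ e : ℕ, SameType F (Fin.snoc a c : Fin (n + 1) → ℕ) (Fin.snoc b e : Fin (n + 1) → ℕ) :=
  (h _ (definable (F := F) (Fin.snoc a c : Fin (n + 1) → ℕ)).exists_snoc).1 ⟨c, fun _ _ => Iff.rfl⟩

theorem eq_iff {n : ℕ} {a b : Fin n → ℕ} (h : SameType F a b) (s t : Fin n) :
    a s = a t ↔ b s = b t :=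
  h _ (.equal s t)

end SameType

variable (F) in
/-- A finite partial map, given by a pair of equivalent tuples. -/
structure PartialIso where
  length : ℕ
  dom : Fin length → ℕ
  cod : Fin length → ℕ
  sameType : SameType F dom cod

namespace PartialIso

/-- The pair `(x, y)` belongs to the partial map. -/
def Rel (s : PartialIso F) (x y : ℕ) : Prop := ∃ l, s.dom l = x ∧ s.cod l = y

/-- Graphs are compared, not tuples: order and repetition in the listing are irrelevant. -/
instance : Preorder (PartialIso F) where
  le s t := ∀ x y, s.Rel x y → t.Rel x y
  le_refl _ _ _ h := h
  le_trans _ _ _ h h' x y hs := h' x y (h x y hs)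

theorem Rel.eq_iff {s : PartialIso F} {x y x' y' : ℕ} (h : s.Rel x y) (h' : s.Rel x' y') :
    x = x' ↔ y = y' := by
  obtain ⟨l, rfl, rfl⟩ := h
  obtain ⟨l', rfl, rfl⟩ := h'
  exact s.sameType.eq_iff l l'

/-- Extension of a partial map by one pair. -/
def snoc (s : PartialIso F) (x y : ℕ) (h : SameType F (Fin.snoc s.dom x : Fin (s.length + 1) → ℕ)
    (Fin.snoc s.cod y : Fin (s.length + 1) → ℕ)) : PartialIso F :=
  ⟨s.length + 1, Fin.snoc s.dom x, Fin.snoc s.cod y, h⟩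

theorem le_snoc (s : PartialIso F) (x y : ℕ) (h) : s ≤ s.snoc x y h := by
  rintro _ _ ⟨l, rfl, rfl⟩
  exact ⟨l.castSucc, Fin.snoc_castSucc (α := fun _ => ℕ) .., Fin.snoc_castSucc (α := fun _ => ℕ) ..⟩

theorem snoc_rel (s : PartialIso F) (x y : ℕ) (h) : (s.snoc x y h).Rel x y :=
  ⟨Fin.last _, Fin.snoc_last (α := fun _ => ℕ) .., Fin.snoc_last (α := fun _ => ℕ) ..⟩

variable (F) in
/-- The partial maps defined at `x`. -/
def definedAt (x : ℕ) : Order.Cofinal (PartialIso F) where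
  carrier := {s | ∃ y, s.Rel x y}
  isCofinal s := by
    obtain ⟨y, hy⟩ := s.sameType.exists_snoc x
    exact ⟨s.snoc x y hy, ⟨y, s.snoc_rel x y hy⟩, s.le_snoc x y hy⟩

variable (F) in
/-- The partial maps with `y` in their range. -/
def reaching (y : ℕ) : Order.Cofinal (PartialIso F) where
  carrier := {s | ∃ x, s.Rel x y}
  isCofinal s := by
    obtain ⟨x, hx⟩ := s.sameType.symm.exists_snoc y
    exact ⟨s.snoc x y hx.symm, ⟨x, s.snoc_rel x y hx.symm⟩, s.le_snoc x y hx.symm⟩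

theorem exists_finset_subset {I : Order.Ideal (PartialIso F)} {g : ℕ → ℕ}
    (hg : ∀ x, ∃ s ∈ I, s.Rel x (g x)) (T : Finset ℕ) : ∃ s ∈ I, ∀ x ∈ T, s.Rel x (g x) := by
  induction T using Finset.induction_on with
  | empty => exact (hg 0).imp fun s hs => ⟨hs.1, by simp⟩
  | insert x T _ ih =>
    obtain ⟨s, hsI, hs⟩ := ih
    obtain ⟨t, htI, ht⟩ := hg x
    obtain ⟨u, huI, hsu, htu⟩ := I.directed s hsI t htI
    refine ⟨u, huI, fun y hy => ?_⟩
    rcases Finset.mem_insert.1 hy with rfl | hy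
    · exact htu _ _ ht
    · exact hsu _ _ (hs y hy)

end PartialIso

/-- By directedness a single `s ∈ I` contains `g` on all entries of a finite `Z`, and equality of
types then transfers `Zᶜ ∈ F i`. -/
theorem mem_aut_of_ideal (hF : ∀ i, IsPrincipalCombination (F i))
    {I : Order.Ideal (PartialIso F)} {g : Equiv.Perm ℕ} (hg : ∀ x, ∃ s ∈ I, s.Rel x (g x)) :
    g ∈ Aut F := by
  intro i
  refine (hF i).fixes g fun Z hZ => ?_
  have hT : (⋃ z ∈ Z, Set.range z).Finite := hZ.biUnion fun z _ => Set.finite_range z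
  obtain ⟨s, -, hs⟩ := PartialIso.exists_finset_subset hg hT.toFinset
  have hp (z : Z) (l : Fin (d i)) : ∃ p, s.dom p = z.1 l ∧ s.cod p = g (z.1 l) :=
    hs _ (by simpa using ⟨z.1, z.2, l, rfl⟩)
  choose p hdom hcod using hp
  have : Countable Z := hZ.countable
  have h := s.sameType _ (Definable.compl_range_mem i p)
  have h₁ : (Set.range fun z => s.dom ∘ p z) = Z := by
    have : (fun z => s.dom ∘ p z) = Subtype.val := funext fun z => funext (hdom z)
    rw [this, Subtype.range_coe]
  have h₂ : (Set.range fun z => s.cod ∘ p z) = permImage g Z := by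
    rw [permImage, Set.image_eq_range]
    exact congrArg Set.range (funext fun z => funext (hcod z))
  simpa only [Set.mem_ofPred_eq, h₁, h₂] using h

/-- Back and forth: equivalent tuples are conjugate under the automorphism group. -/
theorem SameType.mem_orb (hF : ∀ i, IsPrincipalCombination (F i)) {n : ℕ} {a b : Fin n → ℕ}
    (h : SameType F a b) : b ∈ orb (Aut F) a := by
  -- An ideal through `s₀` meeting these countably many cofinal sets has as its union a permutation
  -- taking `a` to `b`.
  let D : ℕ ⊕ ℕ → Order.Cofinal (PartialIso F) :=
    Sum.elim (PartialIso.definedAt F) (PartialIso.reaching F)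
  let s₀ : PartialIso F := ⟨n, a, b, h⟩
  let I := Order.idealOfCofinals s₀ D
  have forth (x : ℕ) : ∃ y, ∃ s ∈ I, s.Rel x y := by
    obtain ⟨s, ⟨y, hy⟩, hs⟩ := Order.cofinal_meets_idealOfCofinals s₀ D (.inl x)
    exact ⟨y, s, hs, hy⟩
  have back (y : ℕ) : ∃ x, ∃ s ∈ I, s.Rel x y := by
    obtain ⟨s, ⟨x, hx⟩, hs⟩ := Order.cofinal_meets_idealOfCofinals s₀ D (.inr y)
    exact ⟨x, s, hs, hx⟩
  have eq_iff {x y x' y' : ℕ} (h : ∃ s ∈ I, s.Rel x y) (h' : ∃ s ∈ I, s.Rel x' y') :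
      x = x' ↔ y = y' := by
    obtain ⟨s, hsI, hs⟩ := h
    obtain ⟨t, htI, ht⟩ := h'
    obtain ⟨u, -, hsu, htu⟩ := I.directed s hsI t htI
    exact (hsu _ _ hs).eq_iff (htu _ _ ht)
  choose f hf using forth
  choose f' hf' using back
  let g : Equiv.Perm ℕ := ⟨f, f', fun x => (eq_iff (hf' (f x)) (hf x)).2 rfl,
    fun y => (eq_iff (hf (f' y)) (hf' y)).1 rfl⟩
  refine ⟨g, mem_aut_of_ideal (I := I) hF hf, fun l => ?_⟩
  exact (eq_iff (hf (a l)) ⟨s₀, Order.mem_idealOfCofinals s₀ D, l, rfl, rfl⟩).1 rfl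

theorem orb_aut_eq (hF : ∀ i, IsPrincipalCombination (F i)) {n : ℕ} (a : Fin n → ℕ) :
    orb (Aut F) a = {b | SameType F a b} := by
  ext b
  refine ⟨?_, fun h => h.mem_orb hF⟩
  rintro ⟨g, hg, hb⟩ A ⟨φ, hφ⟩
  obtain rfl : (fun i => g (a i)) = b := funext hb
  rw [hφ, hφ]
  exact sat_comp_iff hg φ a

end GenQuant

theorem proposition23 {ι : Type*} [Countable ι] (d : ι → ℕ)
    (F : ∀ i, GenQuant.Quantifier (d i))
    (hF : ∀ i, GenQuant.IsPrincipalCombination (F i)) :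
    IsClosed[GenQuant.permTopology] (GenQuant.Aut F : Set (Equiv.Perm ℕ)) ∧
      ∀ (j : ℕ) (a : Fin j → ℕ), GenQuant.Definable F (GenQuant.orb (GenQuant.Aut F) a) := by
  refine ⟨GenQuant.isClosed_aut hF, fun j a => ?_⟩
  rw [GenQuant.orb_aut_eq hF]
  exact GenQuant.SameType.definable a
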